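/- Let $L>0$ and let $n\ge 1$ be an integer with $L\ne \pi n$. Put $\mu_n=\pi n/L$ and let $\lambda_n\neq 0$ be the square root of $\mu_n^2-1$ with $\operatorname{Re}\lambda_n+\operatorname{Im}\lambda_n>0$. For a continuous $L$-periodic function $\epsilon(x)$ with $\int_0^L\epsilon(x)\,dx=0$, let $c_k=\frac1L\int_0^L\epsilon(x)e^{-2\pi i kx/L}\,dx$ be its Fourier coefficients, put $$\alpha_n=\overline{c_n}-(\mu_n+\lambda_n)^2c_{-n},\quad \beta_n=\overline{c_{-n}}-(\mu_n-\lambda_n)^2c_n,$$ $$\tilde\alpha_n=\overline{c_n}-(\mu_n-\lambda_n)^2c_{-n},\quad \tilde\beta_n=\overline{c_{-n}}-(\mu_n+\lambda_n)^2c_n,$$ and consider the Zakharov–Shabat operator with potential $u(x)=1+\epsilon(x)$, $$\mathcal L=\begin{pmatrix} i\partial_x & u\\ -\bar u & -i\partial_x\end{pmatrix}.$$ A divisor point (point of the Dirichlet-type auxiliary spectrum with base point $x_0=0$) is a pair $\gamma=(\lambda(\gamma),\kappa(\gamma))\in\mathbb C^2$ for which there is a nonzero differentiable $\vec\Psi=(\Psi_1,\Psi_2)$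 on $\mathbb R$ with $\mathcal L\vec\Psi=\lambda(\gamma)\vec\Psi$, $\vec\Psi(x+L)=\kappa(\gamma)\vec\Psi(x)$ and $\Psi_1(0)=0$. Its quasimomentum $p(\gamma)$ is defined modulo $2\pi/L$ by $\kappa(\gamma)=e^{iLp(\gamma)}$. There are $r,\epsilon_0,C>0$, depending only on $L$ and $n$, such that for every real $\epsilon\le\epsilon_0$ and every such function $\epsilon(x)$ with $\sup_x|\epsilon(x)|\le\epsilon$ the following holds. 1. There is exactly one divisor point $\gamma_n$ with $|\lambda(\gamma_n)-\lambda_n|<r$, and, for a suitable value of $p(\gamma_n)$, $$\Bigl|\lambda(\gamma_n)-\lambda_n-\tfrac{1}{4\lambda_n}(\alpha_n+\beta_n)\Bigr|\le C\epsilon^2,\qquad \Bigl|p(\gamma_n)-\tfrac{\pi n}{L}-\tfrac{1}{4\mu_n}(\alpha_n-\beta_n)\Bigr|\le C\epsilon^2 .$$ 2. There is exactly one divisor point $\gamma_{-n}$ with $|\lambda(\gamma_{-n})+\lambda_n|<r$, and, for a suitable value of $p(\gamma_{-n})$, $$\Bigl|\lambda(\gamma_{-n})+\lambda_n+\tfrac{1}{4\lambda_n}(\tilde\alpha_n+\tilde\beta_n)\Bigr|\le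 C\epsilon^2,\qquad \Bigl|p(\gamma_{-n})-\tfrac{\pi n}{L}-\tfrac{1}{4\mu_n}(\tilde\alpha_n-\tilde\beta_n)\Bigr|\le C\epsilon^2 .$$ In particular, up to $O(\epsilon^2)$, $p(\gamma_n)=\frac1{4\mu_n}(\alpha_n-\beta_n)$ and $p(\gamma_{-n})=\frac1{4\mu_n}(\tilde\alpha_n-\tilde\beta_n)$ modulo $\pi/L$. -/

import Mathlib

open Real ComplexConjugate

namespace NLSDivisor

/-- The Zakharov–Shabat operator of the self-focusing NLS equation with potential `u`,
`L ψ = (i ψ₁' + u ψ₂, - ū ψ₁ - i ψ₂')`, on vector functions `ψ = (ψ₁, ψ₂) = (ψ · 0, ψ · 1)`. -/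
noncomputable def zsOperator (u : ℝ → ℂ) (ψ : ℝ → Fin 2 → ℂ) : ℝ → Fin 2 → ℂ :=
  fun x => ![Complex.I * deriv (fun y => ψ y 0) x + u x * ψ x 1,
    -conj (u x) * ψ x 0 - Complex.I * deriv (fun y => ψ y 1) x]

/-- `ψ` is a Bloch eigenfunction of the `T`-periodic Zakharov–Shabat operator at the point
`γ = (l, κ)` of the spectral curve: a nonzero solution of `L ψ = l ψ` with Bloch multiplier `κ`,
i.e. `ψ (x + T) = κ ψ x`. -/
structure IsBlochEigenfunction (T : ℝ) (u : ℝ → ℂ) (γ : ℂ × ℂ) (ψ : ℝ → Fin 2 → ℂ) : Prop where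
  differentiable : Differentiable ℝ ψ
  ne_zero : ψ ≠ 0
  eigen : zsOperator u ψ = γ.1 • ψ
  bloch : ∀ x, ψ (x + T) = γ.2 • ψ x

/-- The divisor (auxiliary, or Dirichlet, spectrum) with base point `0`: the points `γ = (l, κ)` of
the spectral curve at which a Bloch eigenfunction has first component vanishing at `x = 0`
(hence also at `x = T`). -/
def divisor (T : ℝ) (u : ℝ → ℂ) : Set (ℂ × ℂ) :=
  {γ | ∃ ψ, IsBlochEigenfunction T u γ ψ ∧ ψ 0 0 = 0}

/-- `p` is a value of the (multivalued) quasimomentum at `γ = (l, κ)`: `κ = exp (i T p)`. -/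
def IsQuasimomentum (T : ℝ) (γ : ℂ × ℂ) (p : ℂ) : Prop :=
  γ.2 = Complex.exp (Complex.I * T * p)

/-- `μ_n = π n / T`. -/
noncomputable def mu (T : ℝ) (n : ℕ) : ℝ := π * n / T

/-- The resonant point `λ_n`: the square root of `μ_n² - 1` that is nonnegative if `μ_n ≥ 1` and
lies on the positive imaginary axis if `μ_n < 1`. -/
noncomputable def lam (T : ℝ) (n : ℕ) : ℂ :=
  if 1 ≤ mu T n then (√(mu T n ^ 2 - 1) : ℂ) else Complex.I * √(1 - mu T n ^ 2)

theorem lam_sq (T : ℝ) (n : ℕ) (hT : 0 < T) : lam T n ^ 2 = (mu T n : ℂ) ^ 2 - 1 := by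
  have h0 : 0 ≤ mu T n := by unfold mu; positivity
  unfold lam
  split_ifs with h
  · rw [← Complex.ofReal_pow, Real.sq_sqrt (by nlinarith)]
    push_cast; ring
  · rw [mul_pow, ← Complex.ofReal_pow, Real.sq_sqrt (by nlinarith), Complex.I_sq]
    push_cast; ring

/-- `α_n = conj c_n - (μ_n + λ_n)² c_{-n}`. -/
noncomputable def alpha (T : ℝ) (c : ℤ → ℂ) (n : ℕ) : ℂ :=
  conj (c n) - (mu T n + lam T n) ^ 2 * c (-n)

/-- `β_n = conj c_{-n} - (μ_n - λ_n)² c_n`. -/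
noncomputable def beta (T : ℝ) (c : ℤ → ℂ) (n : ℕ) : ℂ :=
  conj (c (-n)) - (mu T n - lam T n) ^ 2 * c n

/-- `α̃_n = conj c_n - (μ_n - λ_n)² c_{-n}`. -/
noncomputable def alphaTilde (T : ℝ) (c : ℤ → ℂ) (n : ℕ) : ℂ :=
  conj (c n) - (mu T n - lam T n) ^ 2 * c (-n)

/-- `β̃_n = conj c_{-n} - (μ_n + λ_n)² c_n`. -/
noncomputable def betaTilde (T : ℝ) (c : ℤ → ℂ) (n : ℕ) : ℂ :=
  conj (c (-n)) - (mu T n + lam T n) ^ 2 * c n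

end NLSDivisor

/-! Take a root `l` of `l² = μ² - 1` (either `λ_n` or `-λ_n`) and write the spectral parameter as `l
+ δ`. By uniqueness for linear ODEs, divisor points correspond to zeros in `δ` of the first
component at `T` of the solution starting at `(0, 1)`; the second component there is the multiplier
(`mem_divisor_iff`).

For `u = 1`, `δ = 0` the generator `A` satisfies `A² = -μ²`, so its flow is `cos (μ x) + sin (μ x) /
μ • A`, which at `T` is `(-1)^n` times the identity. Removing this flow (`hasDerivAt_interaction`)
leaves an equation whose generator has size `O(|δ| + ε)`. Its endpoint value is therefore the
initial vector plus the integral of the generator applied to it, with a quadratic error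
(`norm_solution_sub_le`, `exists_endpoint_bound`). The conjugated matrices contain only the
harmonics `e^{±2iμx}` and constants, so the integrals are explicit in `c_n` and `c_{-n}`.

The first component is thus close to `δ J + F₁` with `J = i T l / μ² ≠ 0`. A contraction argument
gives a unique small zero `δ = -F₁ / J + O(ε²)` (`exists_zero_expansion`). Inserting it in the
second component and taking a logarithm gives the quasimomentum (`exists_quasimomentum`). -/

namespace NLSDivisor

/-! ### Linear ODEs: Picard series, uniqueness, first-order perturbation -/

section LinearODE

variable {𝕜 E : Type*} [NontriviallyNormedField 𝕜] [NormedAddCommGroup E] [NormedSpace ℝ E]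
  [NormedSpace 𝕜 E]

theorem norm_integral_le_of_norm_le_pow {g : ℝ → E} {C : ℝ} (n : ℕ)
    (hg : ∀ s, ‖g s‖ ≤ C * |s| ^ n) (x : ℝ) :
    ‖∫ s in (0 : ℝ)..x, g s‖ ≤ C * (|x| ^ (n + 1) / (n + 1)) := by
  have h := integral_pow_abs_sub_uIoc (a := 0) (b := x) (n := n)
  simp only [sub_zero] at h
  rw [intervalIntegral.norm_integral_eq_norm_integral_uIoc, ← h,
    ← MeasureTheory.integral_const_mul]
  refine MeasureTheory.norm_integral_le_of_norm_le ?_ (Filter.Eventually.of_forall fun s => hg s)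
  have : Continuous fun s : ℝ => C * |s| ^ n := by fun_prop
  exact (this.integrableOn_uIcc (a := 0) (b := x)).mono_set Set.uIoc_subset_uIcc

/-- The terms of the Picard series of the linear equation `y' = a y`, `y 0 = v`. -/
noncomputable def picardTerm (a : ℝ → E →L[𝕜] E) (v : E) : ℕ → ℝ → E
  | 0 => fun _ => v
  | n + 1 => fun x => ∫ s in (0 : ℝ)..x, a s (picardTerm a v n s)

variable {a : ℝ → E →L[𝕜] E} {v : E}

theorem continuous_picardTerm (ha : Continuous a) (v : E) (n : ℕ) :
    Continuous (picardTerm a v n) := by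
  induction n with
  | zero => exact continuous_const
  | succ n ih =>
    exact intervalIntegral.continuous_primitive
      (fun _ _ => (ha.clm_apply ih).intervalIntegrable _ _) 0

theorem hasDerivAt_picardTerm_succ [CompleteSpace E] (ha : Continuous a) (v : E) (n : ℕ) (x : ℝ) :
    HasDerivAt (picardTerm a v (n + 1)) (a x (picardTerm a v n x)) x := by
  have h := ha.clm_apply (continuous_picardTerm ha v n)
  exact intervalIntegral.integral_hasDerivAt_right (h.intervalIntegrable _ _)
    h.aestronglyMeasurable.stronglyMeasurableAtFilter h.continuousAt

theorem norm_picardTerm_le {K : ℝ} (hK : ∀ x, ‖a x‖ ≤ K) (v : E) (n : ℕ) (x : ℝ) :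
    ‖picardTerm a v n x‖ ≤ ‖v‖ * (K ^ n / n.factorial) * |x| ^ n := by
  have hK0 : 0 ≤ K := (norm_nonneg _).trans (hK 0)
  induction n generalizing x with
  | zero => simp [picardTerm]
  | succ n ih =>
    have h := norm_integral_le_of_norm_le_pow (C := K * (‖v‖ * (K ^ n / n.factorial))) n
      (g := fun s => a s (picardTerm a v n s)) (fun s => by
        calc _ ≤ ‖a s‖ * ‖picardTerm a v n s‖ := (a s).le_opNorm _
          _ ≤ K * (‖v‖ * (K ^ n / n.factorial) * |s| ^ n) :=
            mul_le_mul (hK s) (ih s) (norm_nonneg _) hK0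
          _ = _ := by ring) x
    refine h.trans_eq ?_
    rw [Nat.factorial_succ]
    push_cast
    field_simp
    ring

/-- The factorial bounds make both the Picard series and its differentiated series converge
uniformly on bounded intervals, so the sum can be differentiated term by term and is a global
solution. -/
theorem exists_linear_ode_solution [CompleteSpace E] (ha : Continuous a) {K : ℝ}
    (hK : ∀ x, ‖a x‖ ≤ K) (v : E) :
    ∃ y : ℝ → E, y 0 = v ∧ ∀ x, HasDerivAt y (a x (y x)) x := by
  have hK0 : 0 ≤ K := (norm_nonneg _).trans (hK 0)
  have hterm : ∀ (R : ℝ) (n : ℕ) (x : ℝ), |x| ≤ R →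
      ‖picardTerm a v n x‖ ≤ ‖v‖ * ((K * R) ^ n / n.factorial) := fun R n x hx => by
    refine (norm_picardTerm_le hK v n x).trans ?_
    calc _ ≤ ‖v‖ * (K ^ n / n.factorial) * R ^ n := by gcongr
      _ = _ := by rw [mul_pow]; ring
  have hsumm : ∀ R : ℝ, Summable fun n : ℕ => ‖v‖ * ((K * R) ^ n / n.factorial) := fun R =>
    (Real.summable_pow_div_factorial _).mul_left _
  have hs : ∀ x, Summable fun n => picardTerm a v n x := fun x =>
    .of_norm_bounded (hsumm |x|) fun n => hterm |x| n x le_rfl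
  refine ⟨fun x => v + ∑' n, picardTerm a v (n + 1) x, ?_, fun x => ?_⟩
  · simp [picardTerm]
  · have hy : v + ∑' n, picardTerm a v (n + 1) x = ∑' n, picardTerm a v n x :=
      ((hs x).tsum_eq_zero_add).symm
    -- The majorants are uniform only for bounded `|x|`, so differentiation takes place on an
    -- interval around `0` containing `x`.
    have hx : x ∈ Set.Ioo (-(|x| + 1)) (|x| + 1) := by
      constructor <;> linarith [neg_abs_le x, le_abs_self x]
    have h := hasDerivAt_tsum_of_isPreconnected (𝕜 := ℝ) ((hsumm (|x| + 1)).mul_left K)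
      (isOpen_Ioo (a := -(|x| + 1)) (b := |x| + 1)) isPreconnected_Ioo
      (g := fun n => picardTerm a v (n + 1)) (g' := fun n x => a x (picardTerm a v n x))
      (fun n y _ => hasDerivAt_picardTerm_succ ha v n y)
      (fun n y hy => by
        calc _ ≤ ‖a y‖ * ‖picardTerm a v n y‖ := (a y).le_opNorm _
          _ ≤ _ := mul_le_mul (hK y) (hterm _ n y (abs_lt.2 hy).le) (norm_nonneg _) hK0)
      hx ((summable_nat_add_iff 1).2 (hs x)) hx
    simp only [hy]
    rw [(a x).map_tsum (hs x)]
    exact h.const_add v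

theorem linear_ode_unique {K : ℝ} (hK : ∀ x, ‖a x‖ ≤ K) {y z : ℝ → E}
    (hy : ∀ x, HasDerivAt y (a x (y x)) x) (hz : ∀ x, HasDerivAt z (a x (z x)) x) {x₀ : ℝ}
    (h : y x₀ = z x₀) : y = z := by
  refine ODE_solution_unique_univ (v := fun x w => a x w) (s := fun _ => Set.univ)
    (K := K.toNNReal) (fun x => ((a x).lipschitz.weaken ?_).lipschitzOnWith)
    (fun x => ⟨hy x, trivial⟩) (fun x => ⟨hz x, trivial⟩) h
  exact NNReal.coe_le_coe.1 (by
    rw [coe_nnnorm, Real.coe_toNNReal']; exact (hK x).trans (le_max_left _ _))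

/-- At a point where `‖w‖` is maximal, the mean value inequality bounds the maximum by `‖w 0‖ + T G`
plus at most half of itself; absorbing that half gives the factor `2`. This replaces the exponential
of Gronwall's inequality. -/
theorem norm_le_of_norm_deriv_le {T η G : ℝ} (hT : 0 ≤ T) (hη : T * η ≤ 1 / 2)
    (hη0 : 0 ≤ η) {w w' : ℝ → E} (hw : ∀ x, HasDerivAt w (w' x) x)
    (hw' : ∀ x ∈ Set.Icc 0 T, ‖w' x‖ ≤ η * ‖w x‖ + G) :
    ∀ x ∈ Set.Icc 0 T, ‖w x‖ ≤ 2 * (‖w 0‖ + T * G) := by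
  have hc : Continuous w := continuous_iff_continuousAt.2 fun x => (hw x).continuousAt
  obtain ⟨m, hm, hmax⟩ := isCompact_Icc.exists_isMaxOn (Set.nonempty_Icc.2 hT)
    hc.norm.continuousOn
  have hmax' : ∀ x ∈ Set.Icc 0 T, ‖w x‖ ≤ ‖w m‖ := hmax
  have hG : 0 ≤ η * ‖w m‖ + G := (norm_nonneg _).trans (hw' m hm)
  have h := norm_image_sub_le_of_norm_deriv_le_segment' (a := 0) (b := T) (C := η * ‖w m‖ + G)
    (fun x _ => (hw x).hasDerivWithinAt)
    (fun x hx => (hw' x (Set.Ico_subset_Icc_self hx)).trans (by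
      gcongr; exact hmax' x (Set.Ico_subset_Icc_self hx))) m hm
  have h1 : (η * ‖w m‖ + G) * (m - 0) ≤ (η * ‖w m‖ + G) * T := by
    gcongr; linarith [hm.2]
  have h2 : ‖w m‖ ≤ ‖w 0‖ + ‖w m - w 0‖ := norm_le_insert' _ _
  have h3 : T * η * ‖w m‖ ≤ 1 / 2 * ‖w m‖ := by gcongr
  intro x hx
  linarith [hmax' x hx]

/-- After subtracting the first-order term, the derivative of the difference is `a (y - z) + (a - b)
(z - v)`. Here `y - z` is at most `4 T d ‖v‖` and `z - v` at most `2 T η ‖v‖`, whence the constant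
`6`. The product `η d` is what matters: it yields a Lipschitz estimate when `a` and `b` are close,
and a quadratic one when `b = 0`. -/
theorem norm_solution_sub_le {b : ℝ → E →L[𝕜] E} {T η d : ℝ} (hT : 0 ≤ T)
    (hη : T * η ≤ 1 / 2) (haη : ∀ x ∈ Set.Icc 0 T, ‖a x‖ ≤ η)
    (hbη : ∀ x ∈ Set.Icc 0 T, ‖b x‖ ≤ η) (hab : ∀ x ∈ Set.Icc 0 T, ‖a x - b x‖ ≤ d)
    (ha : Continuous a) (hb : Continuous b) [CompleteSpace E] {y z : ℝ → E}
    (hy : ∀ x, HasDerivAt y (a x (y x)) x) (hz : ∀ x, HasDerivAt z (b x (z x)) x)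
    (hy0 : y 0 = v) (hz0 : z 0 = v) :
    ‖y T - z T - ∫ x in (0 : ℝ)..T, (a x - b x) v‖ ≤ 6 * T ^ 2 * η * d * ‖v‖ := by
  have h0T : (0 : ℝ) ∈ Set.Icc 0 T := ⟨le_rfl, hT⟩
  have hη0 : 0 ≤ η := (norm_nonneg _).trans (haη 0 h0T)
  have hd0 : 0 ≤ d := (norm_nonneg _).trans (hab 0 h0T)
  have hzb : ∀ x ∈ Set.Icc 0 T, ‖z x‖ ≤ 2 * ‖v‖ := fun x hx => by
    have := norm_le_of_norm_deriv_le hT hη hη0 hz (G := 0) (fun x hx => by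
      rw [add_zero]
      exact ((b x).le_opNorm _).trans (by gcongr; exact hbη x hx)) x hx
    simpa [hz0] using this
  have hzv : ∀ x ∈ Set.Icc 0 T, ‖z x - v‖ ≤ 2 * T * η * ‖v‖ := fun x hx => by
    have := norm_image_sub_le_of_norm_deriv_le_segment' (a := 0) (b := T) (C := η * (2 * ‖v‖))
      (fun x _ => (hz x).hasDerivWithinAt) (fun x hx => ((b x).le_opNorm _).trans (by
        have hx' := Set.Ico_subset_Icc_self hx
        exact mul_le_mul (hbη x hx') (hzb x hx') (norm_nonneg _) hη0)) x hx
    rw [hz0] at this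
    refine this.trans ?_
    calc _ ≤ η * (2 * ‖v‖) * T := by gcongr; linarith [hx.2]
      _ = _ := by ring
  have hD : ∀ x, HasDerivAt (fun x => y x - z x) (a x (y x) - b x (z x)) x := fun x =>
    (hy x).sub (hz x)
  have hDeq : ∀ x, a x (y x) - b x (z x) = a x (y x - z x) + (a x - b x) (z x) := fun x => by
    simp
  have hDb : ∀ x ∈ Set.Icc 0 T, ‖y x - z x‖ ≤ 4 * T * d * ‖v‖ := fun x hx => by
    have := norm_le_of_norm_deriv_le hT hη hη0 hD (G := d * (2 * ‖v‖)) (fun x hx => by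
      rw [hDeq]
      refine norm_add_le_of_le ?_ ?_
      · exact ((a x).le_opNorm _).trans (by gcongr; exact haη x hx)
      · exact ((a x - b x).le_opNorm _).trans
          (mul_le_mul (hab x hx) (hzb x hx) (norm_nonneg _) hd0)) x hx
    simp only [hy0, hz0, sub_self, norm_zero, zero_add] at this
    linarith
  have hcont : Continuous fun x => (a x - b x) v := (ha.sub hb).clm_apply continuous_const
  have hR : ∀ x, HasDerivAt (fun x => y x - z x - ∫ s in (0 : ℝ)..x, (a s - b s) v)
      (a x (y x) - b x (z x) - (a x - b x) v) x := fun x =>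
    (hD x).sub (intervalIntegral.integral_hasDerivAt_right (hcont.intervalIntegrable _ _)
      hcont.aestronglyMeasurable.stronglyMeasurableAtFilter hcont.continuousAt)
  have := norm_image_sub_le_of_norm_deriv_le_segment' (a := 0) (b := T)
    (C := η * (4 * T * d * ‖v‖) + d * (2 * T * η * ‖v‖))
    (fun x _ => (hR x).hasDerivWithinAt) (fun x hx => by
      have hx' := Set.Ico_subset_Icc_self hx
      have : a x (y x) - b x (z x) - (a x - b x) v
          = a x (y x - z x) + (a x - b x) (z x - v) := by
        rw [hDeq, map_sub (a x - b x)]; abel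
      rw [this]
      refine norm_add_le_of_le ?_ ?_
      · exact ((a x).le_opNorm _).trans
          (mul_le_mul (haη x hx') (hDb x hx') (norm_nonneg _) hη0)
      · exact ((a x - b x).le_opNorm _).trans
          (mul_le_mul (hab x hx') (hzv x hx') (norm_nonneg _) hd0)) T ⟨hT, le_rfl⟩
  simp only [hy0, hz0, sub_self, intervalIntegral.integral_same, sub_zero] at this
  linarith

end LinearODE

/-! ### Interaction picture for a generator with `A² = -μ²` -/

section Gauge

variable {E : Type*} [NormedAddCommGroup E] [NormedSpace ℂ E]

/-- `cos (μ x) + sin (μ x) / μ • A`, which is `exp (x A)` if `A² = -μ²`. -/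
noncomputable def propagator (A : E →L[ℂ] E) (μ x : ℝ) : E →L[ℂ] E :=
  Complex.cos (μ * x) • (1 : E →L[ℂ] E) + (Complex.sin (μ * x) / μ) • A

theorem continuous_propagator (A : E →L[ℂ] E) (μ : ℝ) : Continuous (propagator A μ) := by
  unfold propagator
  fun_prop

theorem propagator_mul_neg {A : E →L[ℂ] E} {μ : ℝ} (hμ : μ ≠ 0)
    (hA : A * A = (-(μ : ℂ) ^ 2) • (1 : E →L[ℂ] E)) (x : ℝ) :
    propagator A μ x * propagator A μ (-x) = 1 := by
  have hμ' : (μ : ℂ) ≠ 0 := Complex.ofReal_ne_zero.2 hμ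
  have h := Complex.sin_sq_add_cos_sq (μ * x)
  unfold propagator
  push_cast
  rw [mul_neg, Complex.cos_neg, Complex.sin_neg]
  simp only [add_mul, mul_add, smul_mul_smul_comm, one_mul, mul_one, hA, smul_smul]
  set c := Complex.cos (μ * x)
  set s := Complex.sin (μ * x)
  have h1 : s / μ * (-s / μ) * (-(μ : ℂ) ^ 2) = 1 - c ^ 2 := by
    field_simp
    linear_combination h
  rw [h1]
  module

variable [NormedSpace ℝ E] [IsScalarTower ℝ ℂ E]

/-- This is the rule `(e^{-tA} y)' = e^{-tA} (y' - A y)`, obtained from the closed form by the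
product rule; `A² = -μ²` rewrites the term `A (A y)`. -/
theorem hasDerivAt_propagator_neg_apply {A : E →L[ℂ] E} {μ : ℝ} (hμ : μ ≠ 0)
    (hA : A * A = (-(μ : ℂ) ^ 2) • (1 : E →L[ℂ] E)) {y : ℝ → E} {y' : E} {x : ℝ}
    (hy : HasDerivAt y y' x) :
    HasDerivAt (fun t => propagator A μ (-t) (y t)) (propagator A μ (-x) (y' - A (y x))) x := by
  have hμ' : (μ : ℂ) ≠ 0 := Complex.ofReal_ne_zero.2 hμ
  have hlin : HasDerivAt (fun t : ℂ => (μ : ℂ) * t) μ x := by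
    simpa using (hasDerivAt_id (x : ℂ)).const_mul (μ : ℂ)
  have hc := hlin.ccos.comp_ofReal
  have hs := (hlin.csin.div_const (μ : ℂ)).comp_ofReal
  have hAy : HasDerivAt (fun t => A (y t)) (A y') x :=
    (A.restrictScalars ℝ).hasFDerivAt.comp_hasDerivAt x hy
  have hAA : A (A (y x)) = (-(μ : ℂ) ^ 2) • y x := by
    simpa using congr($hA (y x))
  have h := (hc.smul hy).sub (hs.smul hAy)
  convert h using 1
  · funext t
    simp [propagator, neg_div, sub_eq_add_neg]
  · simp only [propagator, Complex.ofReal_neg, mul_neg, Complex.cos_neg, Complex.sin_neg,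
      add_apply, smul_apply,
      one_apply_eq_self, map_sub, hAA]
    match_scalars <;> field_simp

/-- Passage to the interaction picture. -/
theorem hasDerivAt_interaction {A : E →L[ℂ] E} {μ : ℝ} (hμ : μ ≠ 0)
    (hA : A * A = (-(μ : ℂ) ^ 2) • (1 : E →L[ℂ] E)) {b : ℝ → E →L[ℂ] E} {y : ℝ → E}
    (hy : ∀ x, HasDerivAt y ((A + b x) (y x)) x) (x : ℝ) :
    HasDerivAt (fun t => propagator A μ (-t) (y t))
      ((propagator A μ (-x) * b x * propagator A μ x) (propagator A μ (-x) (y x))) x := by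
  have h := hasDerivAt_propagator_neg_apply hμ hA (hy x)
  have hP : propagator A μ x (propagator A μ (-x) (y x)) = y x := by
    simpa using congr($(propagator_mul_neg hμ hA x) (y x))
  simpa [hP] using h

end Gauge

/-! ### Endpoint value as a function of the spectral shift -/

section Endpoint

variable {E : Type*} [NormedAddCommGroup E] [NormedSpace ℝ E] [NormedSpace ℂ E]
  [IsScalarTower ℝ ℂ E] [CompleteSpace E]

theorem exists_endpoint_bound {Q₁ Q₂ Q₃ : ℝ → E →L[ℂ] E} (h₁ : Continuous Q₁)
    (h₂ : Continuous Q₂) (h₃ : Continuous Q₃) {T : ℝ} (hT : 0 < T) (v : E) :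
    ∃ ρ₀ : ℝ, 0 < ρ₀ ∧ ∃ C : ℝ, 0 < C ∧ ∀ (ρ : ℝ) (e : ℝ → ℂ), ρ ≤ ρ₀ → Continuous e →
      (∀ x, ‖e x‖ ≤ ρ) → ∀ y : ℂ → ℝ → E, (∀ δ, y δ 0 = v) →
      (∀ δ x, HasDerivAt (y δ) ((δ • Q₁ x + e x • Q₂ x + conj (e x) • Q₃ x) (y δ x)) x) →
      (∀ δ δ', ‖δ‖ ≤ ρ → ‖δ'‖ ≤ ρ →
        ‖y δ T - y δ' T - (δ - δ') • ∫ x in (0 : ℝ)..T, Q₁ x v‖ ≤ C * ρ * ‖δ - δ'‖) ∧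
      (∀ δ, ‖δ‖ ≤ ρ → ‖y δ T - v - (δ • (∫ x in (0 : ℝ)..T, Q₁ x v)
        + ∫ x in (0 : ℝ)..T, (e x • Q₂ x v + conj (e x) • Q₃ x v))‖ ≤ C * ρ ^ 2) := by
  obtain ⟨M, hM⟩ : ∃ M : ℝ, 0 < M ∧
      ∀ x ∈ Set.Icc 0 T, ‖Q₁ x‖ ≤ M ∧ ‖Q₂ x‖ ≤ M ∧ ‖Q₃ x‖ ≤ M := by
    obtain ⟨M₁, hM₁⟩ := isCompact_Icc.exists_bound_of_continuousOn h₁.continuousOn (s := Set.Icc 0 T)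
    obtain ⟨M₂, hM₂⟩ := isCompact_Icc.exists_bound_of_continuousOn h₂.continuousOn (s := Set.Icc 0 T)
    obtain ⟨M₃, hM₃⟩ := isCompact_Icc.exists_bound_of_continuousOn h₃.continuousOn (s := Set.Icc 0 T)
    refine ⟨max 1 (max M₁ (max M₂ M₃)), by positivity, fun x hx => ⟨?_, ?_, ?_⟩⟩
    · exact (hM₁ x hx).trans (by simp)
    · exact (hM₂ x hx).trans (by simp)
    · exact (hM₃ x hx).trans (by simp)
  obtain ⟨hM0, hM⟩ := hM
  -- For `ρ ≤ 1 / (6 T M)` the generator bound `3 M ρ` satisfies `T * (3 M ρ) ≤ 1 / 2`. The constant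
  -- `54 = 6 · 3 · 3` comes from the quadratic estimate (the Lipschitz one needs only `18`), and `+
  -- 1` keeps it positive when `v = 0`.
  refine ⟨1 / (6 * T * M), by positivity, 54 * T ^ 2 * M ^ 2 * ‖v‖ + 1, by positivity, ?_⟩
  intro ρ e hρ he heρ y hy0 hy
  have hρ0 : 0 ≤ ρ := (norm_nonneg _).trans (heρ 0)
  have hη : T * (3 * M * ρ) ≤ 1 / 2 := by
    calc T * (3 * M * ρ) ≤ T * (3 * M * (1 / (6 * T * M))) := by gcongr
      _ = 1 / 2 := by field_simp; norm_num
  have hcont : ∀ δ : ℂ, Continuous fun x => δ • Q₁ x + e x • Q₂ x + conj (e x) • Q₃ x :=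
    fun δ => by
      have : Continuous fun x => conj (e x) := Complex.continuous_conj.comp he
      fun_prop
  have hbound : ∀ δ : ℂ, ‖δ‖ ≤ ρ → ∀ x ∈ Set.Icc 0 T,
      ‖δ • Q₁ x + e x • Q₂ x + conj (e x) • Q₃ x‖ ≤ 3 * M * ρ := fun δ hδ x hx => by
    obtain ⟨b₁, b₂, b₃⟩ := hM x hx
    calc _ ≤ ρ * M + ρ * M + ρ * M := by
          refine norm_add_le_of_le (norm_add_le_of_le ?_ ?_) ?_
          · rw [norm_smul]; gcongr
          · rw [norm_smul]; gcongr; exact heρ x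
          · rw [norm_smul, RCLike.norm_conj]; gcongr; exact heρ x
      _ = _ := by ring
  have hi₁ : IntervalIntegrable (fun x => Q₁ x v) MeasureTheory.volume 0 T :=
    (h₁.clm_apply continuous_const).intervalIntegrable _ _
  constructor
  · intro δ δ' hδ hδ'
    have hdiff : ∀ x, (δ • Q₁ x + e x • Q₂ x + conj (e x) • Q₃ x)
        - (δ' • Q₁ x + e x • Q₂ x + conj (e x) • Q₃ x) = (δ - δ') • Q₁ x := fun x => by
      module
    have h := norm_solution_sub_le hT.le hη (hbound δ hδ) (hbound δ' hδ') (d := ‖δ - δ'‖ * M)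
      (fun x hx => by
        rw [hdiff, norm_smul]; gcongr; exact (hM x hx).1)
      (hcont δ) (hcont δ') (hy δ) (hy δ') (hy0 δ) (hy0 δ')
    simp only [hdiff, smul_apply, intervalIntegral.integral_smul] at h
    refine h.trans ?_
    have : 0 ≤ T ^ 2 * M ^ 2 * ‖v‖ * ρ * ‖δ - δ'‖ := by positivity
    have : 0 ≤ ρ * ‖δ - δ'‖ := by positivity
    nlinarith
  · intro δ hδ
    -- Comparison with the zero generator, whose solution is constantly `v`.
    have h := norm_solution_sub_le (b := fun _ => (0 : E →L[ℂ] E)) (z := fun _ => v) hT.le hη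
      (hbound δ hδ) (fun x _ => by rw [norm_zero]; positivity) (d := 3 * M * ρ)
      (fun x hx => by rw [sub_zero]; exact hbound δ hδ x hx)
      (hcont δ) continuous_const (hy δ) (fun x => by simpa using hasDerivAt_const x v)
      (hy0 δ) rfl
    have hi₃ : IntervalIntegrable (fun x => δ • Q₁ x v) MeasureTheory.volume 0 T := hi₁.smul δ
    have hi₂ : IntervalIntegrable (fun x => e x • Q₂ x v + conj (e x) • Q₃ x v)
        MeasureTheory.volume 0 T := by
      have : Continuous fun x => conj (e x) := Complex.continuous_conj.comp he
      exact Continuous.intervalIntegrable (by fun_prop) _ _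
    have heq : (∫ x in (0 : ℝ)..T, (δ • Q₁ x + e x • Q₂ x + conj (e x) • Q₃ x - 0) v)
        = δ • (∫ x in (0 : ℝ)..T, Q₁ x v)
          + ∫ x in (0 : ℝ)..T, (e x • Q₂ x v + conj (e x) • Q₃ x v) := by
      rw [← intervalIntegral.integral_smul, ← intervalIntegral.integral_add hi₃ hi₂]
      simp [add_assoc]
    rw [heq] at h
    refine h.trans ?_
    have : 0 ≤ ρ ^ 2 := by positivity
    nlinarith

end Endpoint

/-! ### Zeros of nearly affine maps -/

/-- The simplified Newton map `δ ↦ δ - F δ / J` contracts by `1 / 2` on the ball of radius `r` and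
preserves the ball of radius `2 ‖F 0‖ / ‖J‖`. The fixed point is found in the small ball, while
uniqueness holds in the large one. -/
theorem exists_unique_zero_of_near_linear {F : ℂ → ℂ} {J : ℂ} (hJ : J ≠ 0) {r : ℝ}
    (hF : ∀ δ δ', ‖δ‖ ≤ r → ‖δ'‖ ≤ r → ‖F δ - F δ' - J * (δ - δ')‖ ≤ ‖J‖ / 2 * ‖δ - δ'‖)
    (h0 : ‖F 0‖ ≤ ‖J‖ / 2 * r) :
    ∃ δ, ‖δ‖ ≤ 2 * ‖F 0‖ / ‖J‖ ∧ F δ = 0 ∧ ∀ δ', ‖δ'‖ ≤ r → F δ' = 0 → δ' = δ := by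
  have hJ' : 0 < ‖J‖ := norm_pos_iff.2 hJ
  have hr : 0 ≤ r := by
    by_contra! h
    nlinarith [norm_nonneg (F 0)]
  set R := 2 * ‖F 0‖ / ‖J‖ with hR
  have hR0 : 0 ≤ R := by positivity
  have hRr : R ≤ r := by rw [hR, div_le_iff₀ hJ']; linarith
  have hRF : ‖F 0‖ = ‖J‖ / 2 * R := by rw [hR]; field_simp
  let g : ℂ → ℂ := fun δ => δ - F δ / J
  have hg : ∀ δ δ', ‖δ‖ ≤ r → ‖δ'‖ ≤ r → ‖g δ - g δ'‖ ≤ 1 / 2 * ‖δ - δ'‖ := fun δ δ' h h' => by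
    have : g δ - g δ' = -(F δ - F δ' - J * (δ - δ')) / J := by
      simp only [g]; field_simp; ring
    rw [this, norm_div, norm_neg, div_le_iff₀ hJ']
    linarith [hF δ δ' h h']
  have hmaps : Set.MapsTo g (Metric.closedBall 0 R) (Metric.closedBall 0 R) := fun δ hδ => by
    rw [mem_closedBall_zero_iff] at hδ ⊢
    have h1 := hg δ 0 (hδ.trans hRr) (by simpa using hr)
    have h2 : ‖g 0‖ = 1 / 2 * R := by
      simp only [g, zero_sub, norm_neg, norm_div, hRF]; field_simp
    have h3 := norm_le_insert' (g δ) (g 0)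
    rw [sub_zero] at h1
    linarith
  have hcontr : ContractingWith (1 / 2) (hmaps.restrict g _ _) := by
    refine ⟨by rw [div_lt_one two_pos]; exact one_lt_two, LipschitzWith.of_dist_le_mul fun x y => ?_⟩
    have hx := mem_closedBall_zero_iff.1 x.2
    have hy := mem_closedBall_zero_iff.1 y.2
    simpa [Subtype.dist_eq, dist_eq_norm] using hg x y (hx.trans hRr) (hy.trans hRr)
  obtain ⟨δ, hδ, hfix, -⟩ := hcontr.exists_fixedPoint' Metric.isClosed_closedBall.isComplete hmaps
    (Metric.mem_closedBall_self hR0) (edist_ne_top _ _)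
  rw [mem_closedBall_zero_iff] at hδ
  have hFδ : F δ = 0 := by
    have : δ - F δ / J = δ := hfix
    have : F δ / J = 0 := by linear_combination -this
    simpa [hJ] using this
  refine ⟨δ, hδ, hFδ, fun δ' hδ' hF' => ?_⟩
  have h := hF δ' δ hδ' (hδ.trans hRr)
  rw [hF', hFδ, sub_zero, zero_sub, norm_neg, norm_mul] at h
  have h2 : ‖δ' - δ‖ ≤ 0 := by
    by_contra! h3
    nlinarith [mul_pos hJ' h3]
  exact sub_eq_zero.1 (norm_le_zero_iff.1 h2)

/-- Zero of the first component `F` and value of the second component `G`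
of a map close to an affine one. -/
theorem exists_zero_expansion {J K : ℂ} (hJ : J ≠ 0) {ρ₀ C C' : ℝ} (hρ₀ : 0 < ρ₀) (hC : 0 < C)
    (hC' : 0 < C') :
    ∃ r₀ : ℝ, 0 < r₀ ∧ ∀ r : ℝ, 0 < r → r ≤ r₀ →
      ∃ ε₀ : ℝ, 0 < ε₀ ∧ ∃ D : ℝ, 0 < D ∧ ∀ (ε : ℝ) (F G : ℂ → ℂ) (F₁ G₁ : ℂ),
      0 ≤ ε → ε ≤ ε₀ → ‖F₁‖ ≤ C' * ε → ‖G₁‖ ≤ C' * ε →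
      (∀ ρ δ δ', ε ≤ ρ → ρ ≤ ρ₀ → ‖δ‖ ≤ ρ → ‖δ'‖ ≤ ρ →
        ‖F δ - F δ' - (δ - δ') * J‖ ≤ C * ρ * ‖δ - δ'‖) →
      (∀ ρ δ, ε ≤ ρ → ρ ≤ ρ₀ → ‖δ‖ ≤ ρ → ‖F δ - (δ * J + F₁)‖ ≤ C * ρ ^ 2) →
      (∀ ρ δ, ε ≤ ρ → ρ ≤ ρ₀ → ‖δ‖ ≤ ρ → ‖G δ - 1 - (δ * K + G₁)‖ ≤ C * ρ ^ 2) →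
      ∃ δ, ‖δ‖ < r ∧ F δ = 0 ∧ (∀ δ', ‖δ'‖ < r → F δ' = 0 → δ' = δ) ∧
        ‖δ - (-F₁ / J)‖ ≤ D * ε ^ 2 ∧
        ‖G δ - 1 - (-F₁ / J * K + G₁)‖ ≤ D * ε ^ 2 ∧
        ‖G δ - 1‖ ≤ D * ε ∧ ‖G δ - 1‖ ≤ 1 / 2 := by
  have hJ' : 0 < ‖J‖ := norm_pos_iff.2 hJ
  -- This bound on `r` makes the nonlinearity `C r` at most `‖J‖ / 2`, as the contraction requires.
  -- The radius is fixed before `ε₀`, so that one radius can later serve both roots.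
  refine ⟨min ρ₀ (‖J‖ / 2 / C), by positivity, fun r hr hr₀ => ?_⟩
  have hrρ : r ≤ ρ₀ := hr₀.trans (min_le_left _ _)
  have hrJ : C * r ≤ ‖J‖ / 2 := by
    rw [mul_comm, ← le_div_iff₀ hC]; exact hr₀.trans (min_le_right _ _)
  set B := C' + C * ρ₀ with hB
  have hB0 : 0 < B := by positivity
  -- `‖F 0‖ ≤ B ε` puts the zero within `(2 B / ‖J‖) ε`; the extra `1` gives `ε ≤ A ε`, so that `ρ =
  -- A ε` is an admissible scale.
  set A := 1 + 2 * B / ‖J‖ with hA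
  have hA1 : 1 ≤ A := by rw [hA]; linarith [show 0 < 2 * B / ‖J‖ by positivity]
  have hA0 : 0 < A := by linarith
  set D₁ := C * A ^ 2 / ‖J‖ with hD₁
  have hD₁0 : 0 < D₁ := by positivity
  set D₂ := C * A ^ 2 + D₁ * ‖K‖ with hD₂
  have hD₂0 : 0 < D₂ := by positivity
  set D₃ := A * ‖K‖ + C' + C * A * ρ₀ with hD₃
  have hD₃0 : 0 < D₃ := by positivity
  obtain ⟨ε₀, hε₀, h1, h2⟩ : ∃ ε₀ : ℝ, 0 < ε₀ ∧ A * ε₀ ≤ r / 2 ∧ D₃ * ε₀ ≤ 1 / 2 :=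
    ⟨min (r / 2 / A) (1 / 2 / D₃), by positivity, by
      rw [mul_comm, ← le_div_iff₀ hA0]; exact min_le_left _ _, by
      rw [mul_comm, ← le_div_iff₀ hD₃0]; exact min_le_right _ _⟩
  refine ⟨ε₀, hε₀, D₁ + D₂ + D₃, by positivity, ?_⟩
  intro ε F G F₁ G₁ hε0 hε hF₁ hG₁ hFl hFq hGq
  have hAε : A * ε ≤ r / 2 := le_trans (by gcongr) h1
  have hεA : ε ≤ A * ε := le_mul_of_one_le_left hε0 hA1
  have hF0 : ‖F 0‖ ≤ B * ε := by
    have h := hFq ε 0 le_rfl (by linarith) (by simpa using hε0)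
    rw [zero_mul, zero_add] at h
    have h' := norm_le_insert' (F 0) F₁
    have : C * ε ^ 2 ≤ C * ρ₀ * ε := by
      rw [sq, ← mul_assoc]; gcongr; linarith
    rw [hB]; linarith
  have hdivF : 2 * ‖F 0‖ / ‖J‖ ≤ A * ε := by
    calc 2 * ‖F 0‖ / ‖J‖ ≤ 2 * (B * ε) / ‖J‖ := by gcongr
      _ = 2 * B / ‖J‖ * ε := by ring
      _ ≤ A * ε := by gcongr; rw [hA]; linarith
  obtain ⟨δ, hδ, hFδ, huniq⟩ := exists_unique_zero_of_near_linear (F := F) hJ (r := r)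
    (fun δ δ' h h' => by
      have := hFl r δ δ' (by linarith) hrρ h h'
      rw [mul_comm J]
      exact this.trans (by gcongr)) (by
      have : 2 * ‖F 0‖ / ‖J‖ ≤ r := by linarith
      rw [div_le_iff₀ hJ'] at this
      linarith)
  have hδA : ‖δ‖ ≤ A * ε := hδ.trans hdivF
  have hAρ : A * ε ≤ ρ₀ := by linarith
  have hX : ‖δ - (-F₁ / J)‖ ≤ D₁ * ε ^ 2 := by
    -- Using the quadratic estimate at scale `A ε` instead of `r` turns its error into `O(ε²)`.
    have h := hFq (A * ε) δ hεA hAρ hδA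
    have heq : δ - (-F₁ / J) = -(F δ - (δ * J + F₁)) / J := by
      rw [hFδ]; field_simp; ring
    rw [heq, norm_div, norm_neg, div_le_iff₀ hJ', hD₁]
    refine h.trans_eq ?_
    field_simp
  have hG := hGq (A * ε) δ hεA hAρ hδA
  have hε2 : 0 ≤ ε ^ 2 := sq_nonneg ε
  have hY : ‖G δ - 1 - (-F₁ / J * K + G₁)‖ ≤ D₂ * ε ^ 2 := by
    have heq : G δ - 1 - (-F₁ / J * K + G₁)
        = (G δ - 1 - (δ * K + G₁)) + (δ - (-F₁ / J)) * K := by ring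
    rw [heq, hD₂]
    have h : ‖(δ - (-F₁ / J)) * K‖ ≤ D₁ * ε ^ 2 * ‖K‖ := by rw [norm_mul]; gcongr
    refine (norm_add_le_of_le hG h).trans_eq ?_
    ring
  have hZ : ‖G δ - 1‖ ≤ D₃ * ε := by
    have h3 := norm_le_insert' (G δ - 1) (δ * K + G₁)
    have h4 : ‖δ * K + G₁‖ ≤ A * ε * ‖K‖ + C' * ε :=
      norm_add_le_of_le (by rw [norm_mul]; gcongr) hG₁
    have h5 : C * (A * ε) ^ 2 ≤ C * A * ρ₀ * ε := by
      calc C * (A * ε) ^ 2 = C * A * (A * ε) * ε := by ring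
        _ ≤ _ := by gcongr
    rw [hD₃]; linarith
  refine ⟨δ, by linarith, hFδ, fun δ' h h' => huniq δ' h.le h', ?_, ?_, ?_, ?_⟩
  · exact hX.trans (by gcongr; linarith)
  · exact hY.trans (by gcongr; linarith)
  · exact hZ.trans (by gcongr; linarith)
  · exact hZ.trans (le_trans (by gcongr) h2)

/-- The sign is `e^{iπn}`, and `z` is close enough to `1` for the principal logarithm to satisfy
`log z = (z - 1) + O(|z - 1|²)`. -/
theorem exists_quasimomentum {T : ℝ} (hT : 0 < T) (n : ℕ) {l z q : ℂ} {d₁ d₂ : ℝ}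
    (h1 : ‖z - 1‖ ≤ d₁) (h2 : ‖z - 1‖ ≤ 1 / 2) (h3 : ‖z - 1 - Complex.I * T * q‖ ≤ d₂) :
    ∃ p, IsQuasimomentum T (l, (-1) ^ n * z) p ∧
      ‖p - (π * n / T + q)‖ ≤ (d₁ ^ 2 + d₂) / T := by
  have hT' : (T : ℂ) ≠ 0 := Complex.ofReal_ne_zero.2 hT.ne'
  have hz : z ≠ 0 := by
    rintro rfl
    norm_num at h2
  refine ⟨π * n / T + Complex.log z / (Complex.I * T), ?_, ?_⟩
  · have : Complex.I * T * (π * n / T + Complex.log z / (Complex.I * T))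
        = n * (π * Complex.I) + Complex.log z := by
      field_simp
    rw [IsQuasimomentum, this, Complex.exp_add, Complex.exp_nat_mul, Complex.exp_pi_mul_I,
      Complex.exp_log hz]
  · have hlog := Complex.norm_log_one_add_sub_self_le (z := z - 1) (by linarith)
    rw [add_sub_cancel] at hlog
    have h4 : (1 - ‖z - 1‖)⁻¹ ≤ 2 := by
      rw [inv_le_comm₀ (by linarith) two_pos]; linarith
    have h5 : ‖Complex.log z - (z - 1)‖ ≤ d₁ ^ 2 := by
      refine hlog.trans ?_
      calc _ ≤ ‖z - 1‖ ^ 2 * 2 / 2 := by gcongr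
        _ = ‖z - 1‖ ^ 2 := by ring
        _ ≤ _ := by gcongr
    have heq : π * n / T + Complex.log z / (Complex.I * T) - (π * n / T + q)
        = ((Complex.log z - (z - 1)) + (z - 1 - Complex.I * T * q)) / (Complex.I * T) := by
      field_simp; ring
    rw [heq, norm_div, norm_mul, Complex.norm_I, one_mul, Complex.norm_real, Real.norm_eq_abs,
      abs_of_pos hT]
    gcongr
    exact norm_add_le_of_le h5 h3

/-! ### The Zakharov–Shabat system and its divisor -/

/-- The continuous linear map on `ℂ²` given by a matrix. -/
noncomputable def matCLM (M : Matrix (Fin 2) (Fin 2) ℂ) : (Fin 2 → ℂ) →L[ℂ] (Fin 2 → ℂ) :=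
  LinearMap.toContinuousLinearMap (Matrix.toLin' M)

/-- The matrix multiplying the spectral parameter in the Zakharov–Shabat system. -/
noncomputable def zsS : (Fin 2 → ℂ) →L[ℂ] (Fin 2 → ℂ) := matCLM !![-Complex.I, 0; 0, Complex.I]

/-- The matrix multiplying the potential in the Zakharov–Shabat system. -/
noncomputable def zsU : (Fin 2 → ℂ) →L[ℂ] (Fin 2 → ℂ) := matCLM !![0, Complex.I; 0, 0]

/-- The matrix multiplying the conjugate potential in the Zakharov–Shabat system. -/
noncomputable def zsV : (Fin 2 → ℂ) →L[ℂ] (Fin 2 → ℂ) := matCLM !![0, 0; Complex.I, 0]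

/-- The generator of the Zakharov–Shabat system written as `y' = zsGen l u y`. -/
noncomputable def zsGen (l u : ℂ) : (Fin 2 → ℂ) →L[ℂ] (Fin 2 → ℂ) :=
  l • zsS + u • zsU + conj u • zsV

theorem zsS_apply (w : Fin 2 → ℂ) : zsS w = ![-Complex.I * w 0, Complex.I * w 1] := by
  ext i; fin_cases i <;> simp [zsS, matCLM, Matrix.mulVec, dotProduct, Fin.sum_univ_two]

theorem zsU_apply (w : Fin 2 → ℂ) : zsU w = ![Complex.I * w 1, 0] := by
  ext i; fin_cases i <;> simp [zsU, matCLM, Matrix.mulVec, dotProduct, Fin.sum_univ_two]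

theorem zsV_apply (w : Fin 2 → ℂ) : zsV w = ![0, Complex.I * w 0] := by
  ext i; fin_cases i <;> simp [zsV, matCLM, Matrix.mulVec, dotProduct, Fin.sum_univ_two]

theorem zsGen_apply (l u : ℂ) (w : Fin 2 → ℂ) :
    zsGen l u w = ![-Complex.I * (l * w 0 - u * w 1), Complex.I * (l * w 1 + conj u * w 0)] := by
  ext i
  fin_cases i <;> simp [zsGen, zsS_apply, zsU_apply, zsV_apply] <;> ring

theorem zsGen_add (l d w : ℂ) :
    zsGen (l + d) (1 + w) = zsGen l 1 + (d • zsS + w • zsU + conj w • zsV) := by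
  simp only [zsGen, map_add, map_one]
  module

/-- Cayley–Hamilton: the matrix is trace-free with determinant `l² + 1 = m²`. -/
theorem zsGen_one_mul_self {l : ℂ} {m : ℝ} (h : l ^ 2 = (m : ℂ) ^ 2 - 1) :
    zsGen l 1 * zsGen l 1 = (-(m : ℂ) ^ 2) • (1 : (Fin 2 → ℂ) →L[ℂ] (Fin 2 → ℂ)) := by
  ext w i
  fin_cases i
  · simp [zsGen_apply]
    linear_combination w 0 * h - (l ^ 2 * w 0 + w 0) * Complex.I_sq
  · simp [zsGen_apply]
    linear_combination (-w 1) * h + (l ^ 2 * w 1 + w 1) * Complex.I_sq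

theorem norm_zsGen_le (l u : ℂ) : ‖zsGen l u‖ ≤ ‖l‖ * ‖zsS‖ + ‖u‖ * (‖zsU‖ + ‖zsV‖) := by
  refine (norm_add₃_le).trans_eq ?_
  rw [norm_smul, norm_smul, norm_smul, RCLike.norm_conj]
  ring

theorem continuous_zsGen (l : ℂ) : Continuous (zsGen l) := by
  unfold zsGen
  have := Complex.continuous_conj
  fun_prop

theorem zsOperator_eq_smul_iff {u : ℝ → ℂ} {l : ℂ} {ψ : ℝ → Fin 2 → ℂ}
    (hψ : Differentiable ℝ ψ) :
    zsOperator u ψ = l • ψ ↔ ∀ x, HasDerivAt ψ (zsGen l (u x) (ψ x)) x := by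
  have hd : ∀ x i, HasDerivAt (fun y => ψ y i) (deriv (fun y => ψ y i) x) x := fun x i =>
    (differentiable_pi.1 hψ i x).hasDerivAt
  constructor
  · intro h x
    rw [hasDerivAt_pi, Fin.forall_fin_two]
    have h0 : Complex.I * deriv (fun y => ψ y 0) x + u x * ψ x 1 = l * ψ x 0 := by
      simpa [zsOperator] using congr($h x 0)
    have h1 : -conj (u x) * ψ x 0 - Complex.I * deriv (fun y => ψ y 1) x = l * ψ x 1 := by
      simpa [zsOperator] using congr($h x 1)
    constructor
    · refine (hd x 0).congr_deriv ?_
      rw [zsGen_apply, Matrix.cons_val_zero]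
      linear_combination -Complex.I * h0 + deriv (fun y => ψ y 0) x * Complex.I_sq
    · refine (hd x 1).congr_deriv ?_
      rw [zsGen_apply, Matrix.cons_val_one, Matrix.cons_val_zero]
      linear_combination Complex.I * h1 + deriv (fun y => ψ y 1) x * Complex.I_sq
  · intro h
    funext x
    have h' := fun i => (hasDerivAt_pi.1 (h x) i).deriv
    ext i
    fin_cases i
    · simp [zsOperator, h', zsGen_apply]
      linear_combination (u x * ψ x 1 - l * ψ x 0) * Complex.I_sq
    · simp [zsOperator, h', zsGen_apply]
      linear_combination -(conj (u x) * ψ x 0 + l * ψ x 1) * Complex.I_sq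

/-- A Bloch function with vanishing first component at `0` is a nonzero multiple of `y`, by
uniqueness. Conversely, periodicity of `u` makes `y (x + T)` a solution, and the endpoint conditions
identify it with `γ.2 • y x` at `x = 0`, hence everywhere. -/
theorem mem_divisor_iff {T M : ℝ} {u : ℝ → ℂ} (hu : Function.Periodic u T)
    (hM : ∀ x, ‖u x‖ ≤ M) {γ : ℂ × ℂ} {y : ℝ → Fin 2 → ℂ} (hy0 : y 0 = ![0, 1])
    (hy : ∀ x, HasDerivAt y (zsGen γ.1 (u x) (y x)) x) :
    γ ∈ divisor T u ↔ y T 0 = 0 ∧ γ.2 = y T 1 := by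
  have hK : ∀ x, ‖zsGen γ.1 (u x)‖ ≤ ‖γ.1‖ * ‖zsS‖ + M * (‖zsU‖ + ‖zsV‖) := fun x =>
    (norm_zsGen_le _ _).trans (by gcongr; exact hM x)
  have hsmul : ∀ k : ℂ, ∀ x, HasDerivAt (fun x => k • y x) (zsGen γ.1 (u x) (k • y x)) x :=
    fun k x => by rw [map_smul]; exact (hy x).const_smul k
  constructor
  · rintro ⟨ψ, ⟨hd, hne, heig, hbl⟩, h0⟩
    rw [zsOperator_eq_smul_iff hd] at heig
    have hψ : ψ = fun x => ψ 0 1 • y x := by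
      refine linear_ode_unique hK heig (hsmul _) (x₀ := 0) ?_
      ext i; fin_cases i <;> simp [hy0, h0]
    have h1 : ψ 0 1 ≠ 0 := fun h => hne (by rw [hψ, h]; funext x; simp)
    have hT := hbl 0
    rw [zero_add, hψ] at hT
    have hT' : y T = γ.2 • y 0 := by
      refine smul_right_injective _ h1 ?_
      simpa [smul_smul, mul_comm] using hT
    simp [hT', hy0]
  · rintro ⟨h0, h1⟩
    have hd : Differentiable ℝ y := fun x => (hy x).differentiableAt
    refine ⟨y, ⟨hd, fun h => ?_, (zsOperator_eq_smul_iff hd).2 hy, ?_⟩, by simp [hy0]⟩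
    · have := congr($h 0 1)
      simp [hy0] at this
    · have hshift : (fun x => y (x + T)) = fun x => γ.2 • y x := by
        refine linear_ode_unique hK (fun x => ?_) (hsmul _) (x₀ := 0) ?_
        · have := (hy (x + T)).comp_add_const x T
          rwa [hu x] at this
        · ext i; fin_cases i <;> simp [hy0, h0, h1]
      exact fun x => congr($hshift x)

/-! ### Integrals against the resonant harmonics -/

section Fourier

variable {T : ℝ} {e : ℝ → ℂ}

theorem intervalIntegral_conj {a b : ℝ} (f : ℝ → ℂ) :
    ∫ x in a..b, conj (f x) = conj (∫ x in a..b, f x) := by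
  simp only [intervalIntegral, integral_conj, map_sub]

theorem fourierCoeffOn_zero_left (hT : 0 < T) (k : ℤ) :
    (T : ℂ) * fourierCoeffOn hT e k
      = ∫ x in (0 : ℝ)..T, Complex.exp (-(2 * π * Complex.I * k * x / T)) * e x := by
  have hT' : (T : ℂ) ≠ 0 := Complex.ofReal_ne_zero.2 hT.ne'
  rw [fourierCoeffOn_eq_integral]
  simp only [fourier_coe_apply, sub_zero, smul_eq_mul, Complex.real_smul]
  push_cast
  rw [← mul_assoc, mul_one_div_cancel hT', one_mul]
  congr 1
  funext x
  congr 2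
  ring

theorem integral_exp_sq_mul (hT : 0 < T) (n : ℕ) :
    ∫ x in (0 : ℝ)..T, Complex.exp (mu T n * x * Complex.I) ^ 2 * e x
      = T * fourierCoeffOn hT e (-n) := by
  rw [fourierCoeffOn_zero_left]
  congr 1
  funext x
  rw [← Complex.exp_nat_mul]
  congr 2
  simp only [mu]; push_cast; ring

theorem integral_exp_neg_sq_mul (hT : 0 < T) (n : ℕ) :
    ∫ x in (0 : ℝ)..T, Complex.exp (-(mu T n * x) * Complex.I) ^ 2 * e x
      = T * fourierCoeffOn hT e n := by
  rw [fourierCoeffOn_zero_left]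
  congr 1
  funext x
  rw [← Complex.exp_nat_mul]
  congr 2
  simp only [mu]; push_cast; ring

theorem conj_exp_sq (m x : ℝ) : conj (Complex.exp (m * x * Complex.I) ^ 2)
    = Complex.exp (-(m * x) * Complex.I) ^ 2 := by
  rw [map_pow, ← Complex.exp_conj]
  simp

theorem integral_exp_sq_mul_conj (hT : 0 < T) (n : ℕ) :
    ∫ x in (0 : ℝ)..T, Complex.exp (mu T n * x * Complex.I) ^ 2 * conj (e x)
      = T * conj (fourierCoeffOn hT e n) := by
  rw [← Complex.conj_ofReal T, ← map_mul, ← integral_exp_neg_sq_mul, ← intervalIntegral_conj]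
  simp_rw [map_mul, ← conj_exp_sq, Complex.conj_conj]

theorem integral_exp_neg_sq_mul_conj (hT : 0 < T) (n : ℕ) :
    ∫ x in (0 : ℝ)..T, Complex.exp (-(mu T n * x) * Complex.I) ^ 2 * conj (e x)
      = T * conj (fourierCoeffOn hT e (-n)) := by
  rw [← Complex.conj_ofReal T, ← map_mul, ← integral_exp_sq_mul, ← intervalIntegral_conj]
  simp_rw [map_mul, conj_exp_sq]

/-- The harmonics `e^{±2iμx}` extract the coefficients of index `∓n`; the terms with `k₃` and `k₆`
vanish because `e` has zero mean. -/
theorem integral_trig_combination (hT : 0 < T) (he : Continuous e) (h0 : ∫ x in (0 : ℝ)..T, e x = 0) (n : ℕ)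
    (k₁ k₂ k₃ k₄ k₅ k₆ : ℂ) :
    ∫ x in (0 : ℝ)..T, (k₁ * (Complex.exp (mu T n * x * Complex.I) ^ 2 * e x)
      + k₂ * (Complex.exp (-(mu T n * x) * Complex.I) ^ 2 * e x) + k₃ * e x
      + k₄ * (Complex.exp (mu T n * x * Complex.I) ^ 2 * conj (e x))
      + k₅ * (Complex.exp (-(mu T n * x) * Complex.I) ^ 2 * conj (e x)) + k₆ * conj (e x))
      = T * (k₁ * fourierCoeffOn hT e (-n) + k₂ * fourierCoeffOn hT e n
        + k₄ * conj (fourierCoeffOn hT e n) + k₅ * conj (fourierCoeffOn hT e (-n))) := by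
  have hc : Continuous fun x => conj (e x) := Complex.continuous_conj.comp he
  have h0' : ∫ x in (0 : ℝ)..T, conj (e x) = 0 := by rw [intervalIntegral_conj, h0, map_zero]
  repeat rw [intervalIntegral.integral_add
    (Continuous.intervalIntegrable (by fun_prop) _ _)
    (Continuous.intervalIntegrable (by fun_prop) _ _)]
  simp only [intervalIntegral.integral_const_mul, integral_exp_sq_mul_conj hT,
    integral_exp_neg_sq_mul_conj hT, h0, h0']
  simp only [integral_exp_sq_mul hT, integral_exp_neg_sq_mul hT]
  ring

theorem integral_exp_sq (hT : 0 < T) {n : ℕ} (hn : n ≠ 0) :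
    ∫ x in (0 : ℝ)..T, Complex.exp (mu T n * x * Complex.I) ^ 2 = 0 := by
  have hT' : (T : ℂ) ≠ 0 := Complex.ofReal_ne_zero.2 hT.ne'
  have hk : (2 * mu T n * Complex.I : ℂ) ≠ 0 := by
    simp [mu, hn, hT', Real.pi_ne_zero]
  have : ∀ x : ℝ, Complex.exp (mu T n * x * Complex.I) ^ 2
      = Complex.exp (2 * mu T n * Complex.I * x) := fun x => by
    rw [← Complex.exp_nat_mul]; congr 1; push_cast; ring
  simp_rw [this]
  rw [integral_exp_mul_complex hk]
  have h1 : (2 * mu T n * Complex.I * T : ℂ) = n * (2 * π * Complex.I) := by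
    simp only [mu]; push_cast; field_simp
  rw [h1, Complex.exp_nat_mul, Complex.exp_two_pi_mul_I]
  simp

theorem integral_trig (hT : 0 < T) {n : ℕ} (hn : n ≠ 0) (k₁ k₂ k₃ : ℂ) :
    ∫ x in (0 : ℝ)..T, (k₁ * Complex.exp (mu T n * x * Complex.I) ^ 2
      + k₂ * Complex.exp (-(mu T n * x) * Complex.I) ^ 2 + k₃) = T * k₃ := by
  have h2 : ∫ x in (0 : ℝ)..T, Complex.exp (-(mu T n * x) * Complex.I) ^ 2 = 0 := by
    simp_rw [← conj_exp_sq]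
    rw [intervalIntegral_conj, integral_exp_sq hT hn, map_zero]
  repeat rw [intervalIntegral.integral_add
    (Continuous.intervalIntegrable (by fun_prop) _ _)
    (Continuous.intervalIntegrable (by fun_prop) _ _)]
  simp only [intervalIntegral.integral_const_mul, integral_exp_sq hT hn, h2]
  simp

end Fourier

/-! ### Harmonics of the conjugated matrices -/

section Interaction

variable {l : ℂ} {m : ℝ}

theorem propagator_zsGen_apply (l : ℂ) (m x : ℝ) (w : Fin 2 → ℂ) :
    propagator (zsGen l 1) m x w
      = ![(Complex.cos (m * x) - Complex.I * l * (Complex.sin (m * x) / m)) * w 0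
            + Complex.I * (Complex.sin (m * x) / m) * w 1,
          Complex.I * (Complex.sin (m * x) / m) * w 0
            + (Complex.cos (m * x) + Complex.I * l * (Complex.sin (m * x) / m)) * w 1] := by
  ext i
  fin_cases i <;> simp [propagator, zsGen_apply] <;> ring

/-- The operator `B` in the interaction picture of the constant-potential problem. -/
noncomputable def interaction (l : ℂ) (m : ℝ) (B : (Fin 2 → ℂ) →L[ℂ] (Fin 2 → ℂ)) (x : ℝ) :
    (Fin 2 → ℂ) →L[ℂ] (Fin 2 → ℂ) :=
  propagator (zsGen l 1) m (-x) * B * propagator (zsGen l 1) m x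

theorem continuous_interaction (l : ℂ) (m : ℝ) (B : (Fin 2 → ℂ) →L[ℂ] (Fin 2 → ℂ)) :
    Continuous (interaction l m B) := by
  have := continuous_propagator (zsGen l 1) m
  unfold interaction
  fun_prop

theorem cos_eq_exp (z : ℂ) :
    Complex.cos z = (Complex.exp (z * Complex.I) + Complex.exp (-z * Complex.I)) / 2 := rfl

theorem sin_eq_exp (z : ℂ) : Complex.sin z
    = -Complex.I * (Complex.exp (z * Complex.I) - Complex.exp (-z * Complex.I)) / 2 := by
  rw [Complex.sin]; ring

theorem exp_mul_exp_neg_mul_I (z : ℂ) :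
    Complex.exp (z * Complex.I) * Complex.exp (-z * Complex.I) = 1 := by
  rw [← Complex.exp_add, neg_mul, add_neg_cancel, Complex.exp_zero]

/-- Only the constant term survives integration over a period. It produces `J`, which is nonzero
exactly because `l ≠ 0`. -/
theorem interaction_zsS_zero (hm : m ≠ 0) (x : ℝ) :
    interaction l m zsS x ![0, 1] 0
      = (-Complex.I / (2 * m) - Complex.I * l / (2 * m ^ 2))
          * Complex.exp (m * x * Complex.I) ^ 2
        + (Complex.I / (2 * m) - Complex.I * l / (2 * m ^ 2))
          * Complex.exp (-(m * x) * Complex.I) ^ 2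
        + Complex.I * l / m ^ 2 := by
  have hm' : (m : ℂ) ≠ 0 := Complex.ofReal_ne_zero.2 hm
  have hE := exp_mul_exp_neg_mul_I (m * x)
  have hI := Complex.I_sq
  simp only [interaction, mul_apply_eq_comp, propagator_zsGen_apply, zsS_apply,
    Matrix.cons_val_zero, Matrix.cons_val_one, Complex.ofReal_neg, mul_neg, Complex.cos_neg,
    Complex.sin_neg]
  rw [cos_eq_exp, sin_eq_exp]
  -- With the exponentials, `I` and `m` as atoms, the claim is a polynomial identity modulo `E * E'
  -- = 1` and `I ^ 2 = -1`.
  generalize Complex.exp (m * x * Complex.I) = E at *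
  generalize Complex.exp (-(m * x) * Complex.I) = E' at *
  generalize Complex.I = I at *
  generalize (m : ℂ) = μ at *
  field_simp
  grind

theorem interaction_zsS_one (hm : m ≠ 0) (hl : l ^ 2 = (m : ℂ) ^ 2 - 1) (x : ℝ) :
    interaction l m zsS x ![0, 1] 1
      = (Complex.I / (2 * m ^ 2)) * Complex.exp (m * x * Complex.I) ^ 2
        + (Complex.I / (2 * m ^ 2)) * Complex.exp (-(m * x) * Complex.I) ^ 2
        + Complex.I * l ^ 2 / m ^ 2 := by
  have hm' : (m : ℂ) ≠ 0 := Complex.ofReal_ne_zero.2 hm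
  have hE := exp_mul_exp_neg_mul_I (m * x)
  have hI := Complex.I_sq
  simp only [interaction, mul_apply_eq_comp, propagator_zsGen_apply, zsS_apply,
    Matrix.cons_val_zero, Matrix.cons_val_one, Complex.ofReal_neg, mul_neg, Complex.cos_neg,
    Complex.sin_neg]
  rw [cos_eq_exp, sin_eq_exp]
  generalize Complex.exp (m * x * Complex.I) = E at *
  generalize Complex.exp (-(m * x) * Complex.I) = E' at *
  generalize Complex.I = I at *
  generalize (m : ℂ) = μ at *
  field_simp
  grind

theorem interaction_potential_zero (hm : m ≠ 0) (hl : l ^ 2 = (m : ℂ) ^ 2 - 1) (x : ℝ)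
    (w w' : ℂ) :
    (w • interaction l m zsU x ![0, 1] + w' • interaction l m zsV x ![0, 1]) 0
      = Complex.I / (4 * m ^ 2) * (m + l) ^ 2 * (Complex.exp (m * x * Complex.I) ^ 2 * w)
        + Complex.I / (4 * m ^ 2) * (m - l) ^ 2 * (Complex.exp (-(m * x) * Complex.I) ^ 2 * w)
        + Complex.I / (2 * m ^ 2) * w
        + -Complex.I / (4 * m ^ 2) * (Complex.exp (m * x * Complex.I) ^ 2 * w')
        + -Complex.I / (4 * m ^ 2) * (Complex.exp (-(m * x) * Complex.I) ^ 2 * w')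
        + Complex.I / (2 * m ^ 2) * w' := by
  have hm' : (m : ℂ) ≠ 0 := Complex.ofReal_ne_zero.2 hm
  have hE := exp_mul_exp_neg_mul_I (m * x)
  have hI := Complex.I_sq
  simp only [interaction, mul_apply_eq_comp, propagator_zsGen_apply, zsU_apply,
    zsV_apply, Pi.add_apply, Pi.smul_apply, smul_eq_mul,
    Matrix.cons_val_zero, Matrix.cons_val_one, Complex.ofReal_neg, mul_neg, Complex.cos_neg,
    Complex.sin_neg]
  rw [cos_eq_exp, sin_eq_exp]
  generalize Complex.exp (m * x * Complex.I) = E at *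
  generalize Complex.exp (-(m * x) * Complex.I) = E' at *
  generalize Complex.I = I at *
  generalize (m : ℂ) = μ at *
  field_simp
  grind

theorem interaction_potential_one (hm : m ≠ 0) (x : ℝ) (w w' : ℂ) :
    (w • interaction l m zsU x ![0, 1] + w' • interaction l m zsV x ![0, 1]) 1
      = -Complex.I / (4 * m ^ 2) * (m + l) * (Complex.exp (m * x * Complex.I) ^ 2 * w)
        + Complex.I / (4 * m ^ 2) * (m - l) * (Complex.exp (-(m * x) * Complex.I) ^ 2 * w)
        + Complex.I * l / (2 * m ^ 2) * w
        + Complex.I / (4 * m ^ 2) * (m - l) * (Complex.exp (m * x * Complex.I) ^ 2 * w')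
        + -Complex.I / (4 * m ^ 2) * (m + l) * (Complex.exp (-(m * x) * Complex.I) ^ 2 * w')
        + Complex.I * l / (2 * m ^ 2) * w' := by
  have hm' : (m : ℂ) ≠ 0 := Complex.ofReal_ne_zero.2 hm
  have hE := exp_mul_exp_neg_mul_I (m * x)
  have hI := Complex.I_sq
  simp only [interaction, mul_apply_eq_comp, propagator_zsGen_apply, zsU_apply,
    zsV_apply, Pi.add_apply, Pi.smul_apply, smul_eq_mul,
    Matrix.cons_val_zero, Matrix.cons_val_one, Complex.ofReal_neg, mul_neg, Complex.cos_neg,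
    Complex.sin_neg]
  rw [cos_eq_exp, sin_eq_exp]
  generalize Complex.exp (m * x * Complex.I) = E at *
  generalize Complex.exp (-(m * x) * Complex.I) = E' at *
  generalize Complex.I = I at *
  generalize (m : ℂ) = μ at *
  field_simp
  grind

end Interaction

/-! ### Assembly: the divisor point near a resonant root -/

theorem exists_norm_integral_le {E : Type*} [NormedAddCommGroup E] [NormedSpace ℝ E]
    [NormedSpace ℂ E] {f g : ℝ → E} (hf : Continuous f) (hg : Continuous g) {T : ℝ}
    (hT : 0 < T) : ∃ C : ℝ, 0 < C ∧ ∀ (ε : ℝ) (e : ℝ → ℂ), (∀ x, ‖e x‖ ≤ ε) →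
      ‖∫ x in (0 : ℝ)..T, (e x • f x + conj (e x) • g x)‖ ≤ C * ε := by
  obtain ⟨M, hM⟩ := isCompact_Icc.exists_bound_of_continuousOn hf.continuousOn (s := Set.Icc 0 T)
  obtain ⟨N, hN⟩ := isCompact_Icc.exists_bound_of_continuousOn hg.continuousOn (s := Set.Icc 0 T)
  have h0T : (0 : ℝ) ∈ Set.Icc 0 T := ⟨le_rfl, hT.le⟩
  have hM0 := (norm_nonneg _).trans (hM 0 h0T)
  have hN0 := (norm_nonneg _).trans (hN 0 h0T)
  refine ⟨(M + N) * T + 1, by positivity, fun ε e he => ?_⟩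
  have hε : 0 ≤ ε := (norm_nonneg _).trans (he 0)
  have h := intervalIntegral.norm_integral_le_of_norm_le_const (a := 0) (b := T)
    (f := fun x => e x • f x + conj (e x) • g x) (C := ε * M + ε * N) (fun x hx => by
      rw [Set.uIoc_of_le hT.le] at hx
      have hx' := Set.Ioc_subset_Icc_self hx
      refine norm_add_le_of_le ?_ ?_
      · rw [norm_smul]; exact mul_le_mul (he x) (hM x hx') (norm_nonneg _) hε
      · rw [norm_smul, RCLike.norm_conj]
        exact mul_le_mul (he x) (hN x hx') (norm_nonneg _) hε)
  rw [sub_zero, abs_of_pos hT] at h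
  linarith

theorem intervalIntegral_apply {f : ℝ → Fin 2 → ℂ} (hf : Continuous f) (a b : ℝ) (i : Fin 2) :
    (∫ x in a..b, f x) i = ∫ x in a..b, f x i :=
  ((ContinuousLinearMap.proj (R := ℝ) (φ := fun _ : Fin 2 => ℂ) i).intervalIntegral_comp_comm
    (hf.intervalIntegrable a b)).symm

theorem mu_pos {T : ℝ} (hT : 0 < T) {n : ℕ} (hn : 1 ≤ n) : 0 < mu T n := by
  have : (0 : ℝ) < n := by exact_mod_cast hn
  unfold mu
  positivity

theorem mu_mul_self {T : ℝ} (hT : 0 < T) (n : ℕ) : mu T n * T = n * π := by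
  unfold mu
  field_simp

/-- Resonance: `μ T = n π`, so the sine term drops out and the cosine is `(-1)^n`. -/
theorem propagator_neg_period {E : Type*} [NormedAddCommGroup E] [NormedSpace ℂ E]
    (A : E →L[ℂ] E) {T : ℝ} (hT : 0 < T) (n : ℕ) :
    propagator A (mu T n) (-T) = ((-1) ^ n : ℂ) • (1 : E →L[ℂ] E) := by
  have h : ((mu T n : ℝ) : ℂ) * ((-T : ℝ) : ℂ) = ((-(n * π) : ℝ) : ℂ) := by
    rw [← mu_mul_self hT n]; push_cast; ring
  rw [propagator, h, ← Complex.ofReal_cos, ← Complex.ofReal_sin, Real.cos_neg, Real.sin_neg,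
    Real.sin_nat_mul_pi, Real.cos_nat_mul_pi]
  simp

theorem exists_zsGen_solution {e : ℝ → ℂ} (he : Continuous e) {ε : ℝ} (hε : ∀ x, ‖e x‖ ≤ ε)
    (l : ℂ) (v : Fin 2 → ℂ) :
    ∃ y : ℝ → Fin 2 → ℂ, y 0 = v ∧ ∀ x, HasDerivAt y (zsGen l (1 + e x) (y x)) x := by
  refine exists_linear_ode_solution ((continuous_zsGen l).comp (continuous_const.add he))
    (K := ‖l‖ * ‖zsS‖ + (1 + ε) * (‖zsU‖ + ‖zsV‖)) (fun x => ?_) v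
  refine (norm_zsGen_le _ _).trans ?_
  gcongr
  exact norm_add_le_of_le norm_one.le (hε x)

theorem hasDerivAt_zs_interaction {l δ : ℂ} {m : ℝ} (hm : m ≠ 0)
    (hl : l ^ 2 = (m : ℂ) ^ 2 - 1) {e : ℝ → ℂ} {y : ℝ → Fin 2 → ℂ}
    (hy : ∀ x, HasDerivAt y (zsGen (l + δ) (1 + e x) (y x)) x) (x : ℝ) :
    HasDerivAt (fun t => propagator (zsGen l 1) m (-t) (y t))
      ((δ • interaction l m zsS x + e x • interaction l m zsU x
        + conj (e x) • interaction l m zsV x) (propagator (zsGen l 1) m (-x) (y x))) x := by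
  have h := hasDerivAt_interaction hm (zsGen_one_mul_self hl)
    (b := fun x => δ • zsS + e x • zsU + conj (e x) • zsV) (y := y)
    (fun x => by rw [← zsGen_add]; exact hy x) x
  refine h.congr_deriv ?_
  congr 1
  simp only [interaction, mul_add, add_mul, mul_smul_comm, smul_mul_assoc]

/-- Only `l ^ 2 = μ ^ 2 - 1` and `l ≠ 0` are needed, so one statement covers both signs of the root.
-/
theorem exists_divisor_point {T : ℝ} (hT : 0 < T) {n : ℕ} (hn : 1 ≤ n) {l : ℂ}
    (hl : l ^ 2 = (mu T n : ℂ) ^ 2 - 1) (hl0 : l ≠ 0) :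
    ∃ r₀ : ℝ, 0 < r₀ ∧ ∀ r : ℝ, 0 < r → r ≤ r₀ → ∃ ε₀ : ℝ, 0 < ε₀ ∧ ∃ C : ℝ, 0 < C ∧
      ∀ (ε : ℝ) (e : ℝ → ℂ), ε ≤ ε₀ → Continuous e → Function.Periodic e T →
        (∫ x in (0 : ℝ)..T, e x) = 0 → (∀ x, ‖e x‖ ≤ ε) → ∀ c : ℤ → ℂ, c = fourierCoeffOn hT e →
        ∀ a b : ℂ, a = conj (c n) - (mu T n + l) ^ 2 * c (-n) →
        b = conj (c (-n)) - (mu T n - l) ^ 2 * c n →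
        ∃ γ : ℂ × ℂ, {γ' ∈ divisor T (fun x => 1 + e x) | ‖γ'.1 - l‖ < r} = {γ} ∧
          ‖γ.1 - (l + 1 / (4 * l) * (a + b))‖ ≤ C * ε ^ 2 ∧
          ∃ p : ℂ, IsQuasimomentum T γ p ∧
            ‖p - (π * n / T + 1 / (4 * mu T n) * (a - b))‖ ≤ C * ε ^ 2 := by
  have hn0 : n ≠ 0 := by omega
  have hm : mu T n ≠ 0 := (mu_pos hT hn).ne'
  have hm' : (mu T n : ℂ) ≠ 0 := Complex.ofReal_ne_zero.2 hm
  have hT' : (T : ℂ) ≠ 0 := Complex.ofReal_ne_zero.2 hT.ne'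
  set m := mu T n with hmdef
  set v : Fin 2 → ℂ := ![0, 1] with hv
  have hv0 : v 0 = 0 := rfl
  have hv1 : v 1 = 1 := rfl
  have hcQ : ∀ B, Continuous fun x => interaction l m B x v := fun B =>
    (continuous_interaction l m B).clm_apply continuous_const
  obtain ⟨ρ₀, hρ₀, C, hC, hend⟩ := exists_endpoint_bound (continuous_interaction l m zsS)
    (continuous_interaction l m zsU) (continuous_interaction l m zsV) hT v
  obtain ⟨C', hC', hint⟩ := exists_norm_integral_le (hcQ zsU) (hcQ zsV) hT
  set J : ℂ := T * (Complex.I * l / m ^ 2) with hJ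
  set K : ℂ := T * (Complex.I * l ^ 2 / m ^ 2) with hK
  have hJ0 : J ≠ 0 := by
    rw [hJ]
    exact mul_ne_zero hT' (div_ne_zero (mul_ne_zero Complex.I_ne_zero hl0) (pow_ne_zero 2 hm'))
  have hq0 : (∫ x in (0 : ℝ)..T, interaction l m zsS x v) 0 = J := by
    rw [intervalIntegral_apply (hcQ zsS)]
    simp only [hv, interaction_zsS_zero hm]
    exact integral_trig hT hn0 _ _ _
  have hq1 : (∫ x in (0 : ℝ)..T, interaction l m zsS x v) 1 = K := by
    rw [intervalIntegral_apply (hcQ zsS)]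
    simp only [hv, interaction_zsS_one hm hl]
    exact integral_trig hT hn0 _ _ _
  obtain ⟨r₀, hr₀, hzero⟩ := exists_zero_expansion (K := K) hJ0 hρ₀ hC hC'
  refine ⟨r₀, hr₀, fun r hr hrr₀ => ?_⟩
  obtain ⟨ε₀, hε₀, D, hD, hzero⟩ := hzero r hr hrr₀
  -- `D` controls the position, and `(D ^ 2 + D) / T` the quasimomentum, where the logarithm
  -- contributes `(D ε)²`.
  refine ⟨ε₀, hε₀, D + (D ^ 2 + D) / T, by positivity, ?_⟩
  rintro ε e hε he hper he0 heε c hc a b ha hb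
  have hε0 : 0 ≤ ε := (norm_nonneg _).trans (heε 0)
  choose Y hY0 hY using fun δ : ℂ => exists_zsGen_solution he heε (l + δ) v
  set y : ℂ → ℝ → Fin 2 → ℂ := fun δ t => propagator (zsGen l 1) m (-t) (Y δ t) with hy
  have hy0 : ∀ δ, y δ 0 = v := fun δ => by simp [hy, propagator, hY0]
  have hyT : ∀ δ, Y δ T = ((-1) ^ n : ℂ) • y δ T := fun δ => by
    simp [hy, hmdef, propagator_neg_period _ hT n, smul_smul, ← mul_pow]
  have hyd : ∀ δ x, HasDerivAt (y δ) ((δ • interaction l m zsS x + e x • interaction l m zsU x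
      + conj (e x) • interaction l m zsV x) (y δ x)) x := fun δ x =>
    hasDerivAt_zs_interaction hm hl (hY δ) x
  set q := ∫ x in (0 : ℝ)..T, (e x • interaction l m zsU x v + conj (e x) • interaction l m zsV x v)
    with hq
  have hcq : Continuous fun x =>
      e x • interaction l m zsU x v + conj (e x) • interaction l m zsV x v := by
    have h1 := hcQ zsU
    have h2 := hcQ zsV
    have h3 : Continuous fun x => conj (e x) := Complex.continuous_conj.comp he
    fun_prop
  have hF₁ : q 0 = -(T * Complex.I / (4 * m ^ 2)) * (a + b) := by
    rw [hq, intervalIntegral_apply hcq]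
    simp only [hv, interaction_potential_zero hm hl]
    rw [integral_trig_combination hT he he0 n, ha, hb, hc]
    ring
  have hG₁ : q 1 = T * Complex.I / (4 * m ^ 2) * (-(m + l) * c (-n) + (m - l) * c n
      + (m - l) * conj (c n) - (m + l) * conj (c (-n))) := by
    rw [hq, intervalIntegral_apply hcq]
    simp only [hv, interaction_potential_one hm]
    rw [integral_trig_combination hT he he0 n, hc]
    ring
  have hFJ : -q 0 / J = 1 / (4 * l) * (a + b) := by
    rw [hF₁, hJ]
    field_simp
  -- The shift of the spectral parameter feeds back into the multiplier through `K`; the relation `l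
  -- ^ 2 = m ^ 2 - 1` collapses the sum to `a - b`.
  have hGK : -q 0 / J * K + q 1 = Complex.I * T * (1 / (4 * m) * (a - b)) := by
    rw [hFJ, hG₁, hK, ha, hb]
    field_simp
    generalize (m : ℂ) = μ at *
    linear_combination (-(c (-n)) * (l + μ) + c n * (μ - l)) * hl
  have hqε : ∀ i, ‖q i‖ ≤ C' * ε := fun i => (norm_le_pi_norm q i).trans (hint ε e heε)
  have hlin : ∀ ρ δ, ε ≤ ρ → ρ ≤ ρ₀ → ‖δ‖ ≤ ρ → _ := fun ρ δ h1 h2 h3 =>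
    (hend ρ e h2 he (fun x => (heε x).trans h1) y hy0 hyd).2 δ h3
  obtain ⟨δ, hδr, hFδ, huniq, hδ, hG, hG', hG''⟩ := hzero ε (fun δ => y δ T 0) (fun δ => y δ T 1)
    (q 0) (q 1) hε0 hε (hqε 0) (hqε 1)
    (fun ρ δ δ' h1 h2 h3 h4 => by
      have h := (hend ρ e h2 he (fun x => (heε x).trans h1) y hy0 hyd).1 δ δ' h3 h4
      have := (norm_le_pi_norm _ 0).trans h
      simpa [hq0] using this)
    (fun ρ δ h1 h2 h3 => by
      have := (norm_le_pi_norm _ 0).trans (hlin ρ δ h1 h2 h3)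
      simpa [hq0, hv0, ← hq] using this)
    (fun ρ δ h1 h2 h3 => by
      have := (norm_le_pi_norm _ 1).trans (hlin ρ δ h1 h2 h3)
      simpa [hq1, hv1, ← hq] using this)
  have hmem : ∀ γ : ℂ × ℂ, γ ∈ divisor T (fun x => 1 + e x) ↔
      y (γ.1 - l) T 0 = 0 ∧ γ.2 = (-1) ^ n * y (γ.1 - l) T 1 := fun γ => by
    rw [mem_divisor_iff (M := 1 + ε) (y := Y (γ.1 - l)) (fun x => by simp [hper x])
      (fun x => norm_add_le_of_le norm_one.le (heε x)) (hY0 _)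
      (fun x => by simpa using hY (γ.1 - l) x), hyT]
    simp
  rw [hFJ] at hδ
  rw [hGK] at hG
  obtain ⟨p, hp, hpε⟩ := exists_quasimomentum hT n (l := l + δ) hG' hG'' hG
  have hε2 : 0 ≤ ε ^ 2 := sq_nonneg ε
  have hpos : 0 ≤ (D ^ 2 + D) / T := by positivity
  refine ⟨(l + δ, (-1) ^ n * y δ T 1), ?_, ?_, p, hp, hpε.trans ?_⟩
  · ext γ
    simp only [Set.mem_ofPred_eq, Set.mem_singleton_iff, hmem]
    constructor
    · rintro ⟨⟨h1, h2⟩, h3⟩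
      have h4 := huniq _ h3 h1
      rw [h4] at h2
      exact Prod.ext (by simp [← h4]) h2
    · rintro rfl
      simpa using ⟨hFδ, hδr⟩
  · rw [add_sub_add_left_eq_sub]
    refine hδ.trans ?_
    gcongr
    linarith
  · calc ((D * ε) ^ 2 + D * ε ^ 2) / T = (D ^ 2 + D) / T * ε ^ 2 := by ring
      _ ≤ _ := by gcongr; linarith

theorem lam_ne_zero {T : ℝ} (hT : 0 < T) {n : ℕ} (hn : 1 ≤ n) (hres : T ≠ π * n) :
    lam T n ≠ 0 := by
  intro h
  have hsq := lam_sq T n hT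
  rw [h] at hsq
  have h1 : mu T n ^ 2 = 1 := by
    have : ((mu T n ^ 2 : ℝ) : ℂ) = (1 : ℝ) := by push_cast; linear_combination -hsq
    exact_mod_cast this
  have h2 : mu T n = 1 := by nlinarith [mu_pos hT hn]
  have h3 := mu_mul_self hT n
  rw [h2] at h3
  exact hres (by linarith)

end NLSDivisor

theorem mainTheorem6 (T : ℝ) (hT : 0 < T) (n : ℕ) (hn : 1 ≤ n) (hres : T ≠ π * n) :
    ∃ r : ℝ, 0 < r ∧ ∃ ε₀ : ℝ, 0 < ε₀ ∧ ∃ C : ℝ, 0 < C ∧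
      ∀ (ε : ℝ) (e : ℝ → ℂ), ε ≤ ε₀ → Continuous e → Function.Periodic e T →
        (∫ x in (0 : ℝ)..T, e x) = 0 → (∀ x, ‖e x‖ ≤ ε) →
        (∃ γ : ℂ × ℂ, {γ' ∈ NLSDivisor.divisor T (fun x => 1 + e x) | ‖γ'.1 - NLSDivisor.lam T n‖ < r} = {γ} ∧
          ‖γ.1 - (NLSDivisor.lam T n
            + 1 / (4 * NLSDivisor.lam T n)
              * (NLSDivisor.alpha T (fourierCoeffOn hT e) n + NLSDivisor.beta T (fourierCoeffOn hT e) n))‖ ≤ C * ε ^ 2 ∧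
          ∃ p : ℂ, NLSDivisor.IsQuasimomentum T γ p ∧
            ‖p - (π * n / T + 1 / (4 * NLSDivisor.mu T n)
              * (NLSDivisor.alpha T (fourierCoeffOn hT e) n - NLSDivisor.beta T (fourierCoeffOn hT e) n))‖ ≤ C * ε ^ 2) ∧
        (∃ γ : ℂ × ℂ, {γ' ∈ NLSDivisor.divisor T (fun x => 1 + e x) | ‖γ'.1 - (-NLSDivisor.lam T n)‖ < r} = {γ} ∧
          ‖γ.1 - (-NLSDivisor.lam T n
            - 1 / (4 * NLSDivisor.lam T n)
              * (NLSDivisor.alphaTilde T (fourierCoeffOn hT e) n + NLSDivisor.betaTilde T (fourierCoeffOn hT e) n))‖ ≤ C * ε ^ 2 ∧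
          ∃ p : ℂ, NLSDivisor.IsQuasimomentum T γ p ∧
            ‖p - (π * n / T + 1 / (4 * NLSDivisor.mu T n)
              * (NLSDivisor.alphaTilde T (fourierCoeffOn hT e) n - NLSDivisor.betaTilde T (fourierCoeffOn hT e) n))‖ ≤ C * ε ^ 2) := by
  have hl := NLSDivisor.lam_sq T n hT
  have hl0 := NLSDivisor.lam_ne_zero hT hn hres
  obtain ⟨r₁, hr₁, h₁⟩ := NLSDivisor.exists_divisor_point hT hn hl hl0
  obtain ⟨r₂, hr₂, h₂⟩ := NLSDivisor.exists_divisor_point hT hn (l := -NLSDivisor.lam T n)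
    (by rw [neg_sq, hl]) (neg_ne_zero.2 hl0)
  -- A common radius is possible since every radius up to `r₁`, respectively `r₂`, is allowed.
  obtain ⟨ε₁, hε₁, C₁, hC₁, h₁⟩ := h₁ (min r₁ r₂) (lt_min hr₁ hr₂) (min_le_left _ _)
  obtain ⟨ε₂, hε₂, C₂, hC₂, h₂⟩ := h₂ (min r₁ r₂) (lt_min hr₁ hr₂) (min_le_right _ _)
  refine ⟨min r₁ r₂, lt_min hr₁ hr₂, min ε₁ ε₂, lt_min hε₁ hε₂, max C₁ C₂, lt_max_of_lt_left hC₁, ?_⟩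
  intro ε e hε he hper he0 heε
  have hC₁' : C₁ * ε ^ 2 ≤ max C₁ C₂ * ε ^ 2 := by gcongr; exact le_max_left _ _
  have hC₂' : C₂ * ε ^ 2 ≤ max C₁ C₂ * ε ^ 2 := by gcongr; exact le_max_right _ _
  constructor
  · obtain ⟨γ, hγ, hγl, p, hp, hpl⟩ := h₁ ε e (hε.trans (min_le_left _ _)) he hper he0 heε _ rfl
      (NLSDivisor.alpha T (fourierCoeffOn hT e) n) (NLSDivisor.beta T (fourierCoeffOn hT e) n)
      rfl rfl
    exact ⟨γ, hγ, hγl.trans hC₁', p, hp, hpl.trans hC₁'⟩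
  -- Replacing `λ_n` by `-λ_n` exchanges `μ + λ` and `μ - λ`, which turns `α, β` into `α̃, β̃` and
  -- flips the sign of `1 / (4 λ)`.
  · obtain ⟨γ, hγ, hγl, p, hp, hpl⟩ := h₂ ε e (hε.trans (min_le_right _ _)) he hper he0 heε _ rfl
      (NLSDivisor.alphaTilde T (fourierCoeffOn hT e) n)
      (NLSDivisor.betaTilde T (fourierCoeffOn hT e) n)
      (by simp only [NLSDivisor.alphaTilde]; ring) (by simp only [NLSDivisor.betaTilde]; ring)
    refine ⟨γ, hγ, le_trans (le_of_eq ?_) (hγl.trans hC₂'), p, hp, hpl.trans hC₂'⟩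
    congr 1
    ring
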